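/- **Setting.** Let $\mathcal H$ be a real Hilbert space and $M$ a bounded linear, self-adjoint, strongly positive operator on $\mathcal H$; write $\langle x,y\rangle_M=\langle x,My\rangle$, $\|x\|_M=\sqrt{\langle x,Mx\rangle}$, $\|x\|_{M^{-1}}=\sqrt{\langle x,M^{-1}x\rangle}$. Let $\beta\ge 0$, let $A\colon\mathcal H\to 2^{\mathcal H}$ be maximally monotone, and let $C\colon\mathcal H\to\mathcal H$ be $\frac1\beta$-cocoercive with respect to $\|\cdot\|_M$, i.e. $\beta\langle Cx-Cy,x-y\rangle\ge\|Cx-Cy\|_{M^{-1}}^2$ for all $x,y$. Assume that $\operatorname{zer}(A+C)=\{x: 0\in Ax+Cx\}$ is nonempty. **Algorithm.** Let $(\gamma_n)_{n\ge0}$, $(\lambda_n)_{n\ge0}$ be strictly positive, $(\zeta_n)_{n\ge0}$, $(\mu_n)_{n\ge0}$ non-negative real sequences, $\bar\beta\ge\beta$, and, for all $n\in\mathbb N=\{0,1,\dots\}$, $$\alpha_n=\tfrac{\mu_n}{\lambda_n+\mu_n},\quad \bar\alpha_n=\tfrac{\gamma_n\mu_n}{\gamma_{n-1}(\lambda_n+\mu_n)},\quad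 \theta_n=(4-\gamma_n\bar\beta)(\lambda_n+\mu_n)-2\lambda_n^2,$$ $$\hat\theta_n=2\lambda_n+2\mu_n-\gamma_n\bar\beta\lambda_n^2,\quad \bar\theta_n=\lambda_n+\mu_n-\lambda_n^2,\quad \tilde\theta_n=(\lambda_n+\mu_n)\gamma_n\bar\beta .$$ Let $x_0\in\mathcal H$, $y_{-1}=p_{-1}=z_{-1}=x_0$, $u_0=v_0=0$, $\gamma_{-1}=\gamma_0$, and let sequences in $\mathcal H$ satisfy, for all $n\in\mathbb N$, $$\begin{aligned} y_n&=x_n+\alpha_n(y_{n-1}-x_n)+u_n,\\ z_n&=x_n+\alpha_n(p_{n-1}-x_n)+\bar\alpha_n(z_{n-1}-p_{n-1})+\tfrac{\bar\theta_n\gamma_n\bar\beta}{\hat\theta_n}u_n+v_n,\\ p_n&=(M+\gamma_nA)^{-1}(Mz_n-\gamma_nCy_n),\\ x_{n+1}&=x_n+\lambda_n(p_n-z_n)+\bar\alpha_n\lambda_n(z_{n-1}-p_{n-1}),\end{aligned}$$ where the vectors $u_{n+1},v_{n+1}$ are arbitrary subject to $$(\lambda_{n+1}+\mu_{n+1})\Big(\tfrac{\tilde\theta_{n+1}}{\hat\theta_{n+1}}\|u_{n+1}\|_M^2+\tfrac{\hat\theta_{n+1}}{\theta_{n+1}}\|v_{n+1}\|_M^2\Big)\le\zeta_{n+1}\ell_n,$$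 with $$r_n=p_n-x_n+\alpha_n(x_n-p_{n-1})+\tfrac{\gamma_n\bar\beta\lambda_n^2}{\hat\theta_n}u_n-\tfrac{2\bar\theta_n}{\theta_n}v_n,$$ $$\ell_n=\tfrac{\theta_n}2\|r_n\|_M^2+2\mu_n\gamma_n\Big\langle\tfrac{z_n-p_n}{\gamma_n}-\tfrac{z_{n-1}-p_{n-1}}{\gamma_{n-1}},\,p_n-p_{n-1}\Big\rangle_M+\tfrac{\mu_n\gamma_n\bar\beta}2\|p_n-y_n-(p_{n-1}-y_{n-1})\|_M^2 .$$ **Parameter assumptions.** Let $\varepsilon>0$ and $\epsilon_0,\epsilon_1\ge0$ be constants such that for all $n\in\mathbb N$: $\mu_n=\frac1{\lambda_0}\lambda_n^2-\lambda_n$; $0\le\zeta_n\le1-\epsilon_0$; $\varepsilon\le\gamma_n\bar\beta\le4-2\lambda_0-\varepsilon$; $\lambda_{n+1}\ge\lambda_n$; and $\gamma_{n+1}\lambda_{n+1}-\gamma_n\lambda_n\le\gamma_{n+1}\lambda_0-\epsilon_1$. **Theorem.** Let $x^\star\in\operatorname{zer}(A+C)$ be arbitrary, and put $\phi_n=\big\langle\tfrac{z_n-p_n}{\gamma_n},p_n-x^\star\big\rangle_M+\tfrac{\bar\beta}4\|y_n-p_n\|_M^2$,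 $V_0=\|x_0-x^\star\|_M^2$ and $V_{n+1}=\|x_{n+1}-x^\star\|_M^2+2\lambda_{n+1}\gamma_{n+1}\alpha_{n+1}\phi_n+\ell_n$ for $n\in\mathbb N$. Then: 1. $(V_n)$ converges, and $\ell_n\le V_{n+1}\le\|x_0-x^\star\|_M^2$ for all $n\in\mathbb N$; 2. if $\lambda_n\to\infty$, then for all $n\in\mathbb N$, $\displaystyle\|r_n\|_M^2\le\frac{2\lambda_0\|x_0-x^\star\|_M^2}{(4-\gamma_n\bar\beta-2\lambda_0)\lambda_n^2}$; 3. if $\epsilon_0>0$, then $(\ell_n)$ is summable; 4. if $\epsilon_0>0$, then $\lambda_nu_n\to0$, $\lambda_nv_n\to0$ and $x_{n+1}-x_n\to0$; 5. if $\epsilon_1>0$, then $(\phi_n)$ is summable; 6. if $\epsilon_1>0$ and $\bar\beta>\beta$, then $(\|y_n-p_n\|_M^2)$ is summable; 7. if $\epsilon_0,\epsilon_1>0$, $(\lambda_n)$ is bounded, and $p_n-x_n\to0$, $y_n-p_n\to0$, $z_n-p_n\to0$, then $(p_n)$ converges weakly to some point of $\operatorname{zer}(A+C)$; 8. if $\epsilon_0,\epsilon_1>0$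 and $(\lambda_n)$ is constant, then $(p_n)$ converges weakly to some point of $\operatorname{zer}(A+C)$. -/

import Mathlib

open Filter Topology

noncomputable section

namespace MomentumFB

variable {H : Type*} [NormedAddCommGroup H] [InnerProductSpace ℝ H]

/-! ### Metrics induced by strongly positive operators -/

/-- `M` is a (bounded, linear) self-adjoint and strongly positive operator on `H`. -/
def IsStronglyPositive [CompleteSpace H] (M : H →L[ℝ] H) : Prop :=
  IsSelfAdjoint M ∧ ∃ c : ℝ, 0 < c ∧ ∀ x : H, c * ‖x‖ ^ 2 ≤ inner ℝ x (M x)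

/-- The bilinear form `⟨x, y⟩_M = ⟨x, M y⟩`. -/
def mInner (M : H →L[ℝ] H) (x y : H) : ℝ := inner ℝ x (M y)

/-- The norm `‖x‖_M = √⟨x, M x⟩`. -/
def mNorm (M : H →L[ℝ] H) (x : H) : ℝ := Real.sqrt (inner ℝ x (M x))

/-- Strongly positive operators are invertible, so that `M.inverse` is the genuine inverse. -/
theorem IsStronglyPositive.isInvertible [CompleteSpace H] {M : H →L[ℝ] H}
    (hM : IsStronglyPositive M) : M.IsInvertible := by
  obtain ⟨-, c, hc, h⟩ := hM
  have hco : IsCoercive ((innerSL ℝ).comp M : H →L[ℝ] H →L[ℝ] ℝ) := by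
    refine ⟨c, hc, fun u => ?_⟩
    have h1 := h u
    rw [real_inner_comm] at h1
    simpa [pow_two, mul_assoc] using h1
  refine ⟨hco.continuousLinearEquivOfBilin, ?_⟩
  ext v
  refine (hco.unique_continuousLinearEquivOfBilin (v := v) (f := M v) fun w => ?_).symm
  simp

/-! ### Set-valued operators -/

/-- The graph of a set-valued operator. -/
def graph (A : H → Set H) : Set (H × H) := {q | q.2 ∈ A q.1}

/-- Monotonicity of a set-valued operator. -/
def IsMonotone (A : H → Set H) : Prop :=
  ∀ q ∈ graph A, ∀ r ∈ graph A, 0 ≤ inner ℝ (q.2 - r.2) (q.1 - r.1)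

/-- Maximal monotonicity: no monotone operator has a graph properly containing that of `A`. -/
def IsMaximallyMonotone (A : H → Set H) : Prop :=
  IsMonotone A ∧ ¬ ∃ B : H → Set H, IsMonotone B ∧ graph A ⊂ graph B

/-- The set-valued sum `A + C` of a set-valued and a single-valued operator. -/
def addSingle (A : H → Set H) (C : H → H) : H → Set H :=
  fun x => {w | ∃ a ∈ A x, w = a + C x}

/-- The set of zeros of a set-valued operator. -/
def zer (T : H → Set H) : Set H := {x | (0 : H) ∈ T x}

/-- The set-valued operator `M + γ A`. -/
def metricPlus (M : H →L[ℝ] H) (γ : ℝ) (A : H → Set H) : H → Set H :=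
  fun x => {w | ∃ a ∈ A x, w = M x + γ • a}

/-- The inverse of a set-valued operator: `p ∈ T⁻¹ w` if and only if `w ∈ T p`. -/
def setInverse (T : H → Set H) : H → Set H := fun w => {p | w ∈ T p}

/-- `C` is `1/β`-cocoercive with respect to `‖·‖_M`. -/
def IsCocoercive (M : H →L[ℝ] H) (β : ℝ) (C : H → H) : Prop :=
  ∀ x y : H, mNorm M.inverse (C x - C y) ^ 2 ≤ β * inner ℝ (C x - C y) (x - y)

/-- The assumptions on the inclusion problem `0 ∈ A x + C x`. -/
structure InclusionAssumption [CompleteSpace H] (M : H →L[ℝ] H) (β : ℝ)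
    (A : H → Set H) (C : H → H) : Prop where
  beta_nonneg : 0 ≤ β
  metric : IsStronglyPositive M
  maximal : IsMaximallyMonotone A
  cocoercive : IsCocoercive M β C
  zer_nonempty : (zer (addSingle A C)).Nonempty

/-! ### The algorithm -/

/-- `prev a s n` is `s (n - 1)`, with the convention that the entry of index `-1` is `a`. -/
def prev {α : Type*} (a : α) (s : ℕ → α) : ℕ → α
  | 0 => a
  | n + 1 => s n

/-- The scalar inputs of the algorithm. -/
structure Params where
  /-- step sizes `γ n` -/
  γ : ℕ → ℝ
  /-- relaxation parameters `λ n` -/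
  lam : ℕ → ℝ
  /-- safeguarding parameters `ζ n` -/
  ζ : ℕ → ℝ
  /-- momentum parameters `μ n` -/
  μ : ℕ → ℝ
  /-- the constant `β̄` -/
  βbar : ℝ

namespace Params

variable (P : Params)

/-- `γ (n - 1)`, with `γ (-1) = γ 0`. -/
def γprev (n : ℕ) : ℝ := prev (P.γ 0) P.γ n

/-- `α n` -/
def α (n : ℕ) : ℝ := P.μ n / (P.lam n + P.μ n)

/-- `ᾱ n` -/
def αbar (n : ℕ) : ℝ := P.γ n * P.μ n / (P.γprev n * (P.lam n + P.μ n))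

/-- `θ n` -/
def θ (n : ℕ) : ℝ := (4 - P.γ n * P.βbar) * (P.lam n + P.μ n) - 2 * P.lam n ^ 2

/-- `θ̂ n` -/
def θhat (n : ℕ) : ℝ := 2 * P.lam n + 2 * P.μ n - P.γ n * P.βbar * P.lam n ^ 2

/-- `θ̄ n` -/
def θbar (n : ℕ) : ℝ := P.lam n + P.μ n - P.lam n ^ 2

/-- `θ̃ n` -/
def θtilde (n : ℕ) : ℝ := (P.lam n + P.μ n) * P.γ n * P.βbar

/-- The requirements on the scalar inputs of the algorithm. -/
structure Admissible (β : ℝ) : Prop where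
  γ_pos : ∀ n, 0 < P.γ n
  lam_pos : ∀ n, 0 < P.lam n
  ζ_nonneg : ∀ n, 0 ≤ P.ζ n
  μ_nonneg : ∀ n, 0 ≤ P.μ n
  beta_le : β ≤ P.βbar

/-- The assumptions on the parameter sequences, with constants `ε`, `ε₀`, `ε₁`. -/
structure Assumption (β ε ε₀ ε₁ : ℝ) : Prop where
  ε_pos : 0 < ε
  ε₀_nonneg : 0 ≤ ε₀
  ε₁_nonneg : 0 ≤ ε₁
  lam_zero_pos : 0 < P.lam 0
  μ_eq : ∀ n, P.μ n = 1 / P.lam 0 * P.lam n ^ 2 - P.lam n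
  ζ_nonneg : ∀ n, 0 ≤ P.ζ n
  ζ_le : ∀ n, P.ζ n ≤ 1 - ε₀
  le_γ_mul : ∀ n, ε ≤ P.γ n * P.βbar
  γ_mul_le : ∀ n, P.γ n * P.βbar ≤ 4 - 2 * P.lam 0 - ε
  lam_mono : ∀ n, P.lam n ≤ P.lam (n + 1)
  growth : ∀ n, P.γ (n + 1) * P.lam (n + 1) - P.γ n * P.lam n ≤ P.γ (n + 1) * P.lam 0 - ε₁
  beta_le : β ≤ P.βbar

end Params

/-- The sequences produced by the algorithm, including the deviations `u`, `v`. -/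
structure Iterates (H : Type*) where
  /-- main iterates `x n` -/
  x : ℕ → H
  /-- forward points `y n` -/
  y : ℕ → H
  /-- backward points `z n` -/
  z : ℕ → H
  /-- outputs `p n` of the forward--backward step -/
  p : ℕ → H
  /-- deviations `u n` -/
  u : ℕ → H
  /-- deviations `v n` -/
  v : ℕ → H

namespace Iterates

variable (S : Iterates H) (P : Params) (M : H →L[ℝ] H)

/-- `y (n - 1)`, with `y (-1) = x 0`. -/
def yprev (n : ℕ) : H := prev (S.x 0) S.y n

/-- `z (n - 1)`, with `z (-1) = x 0`. -/
def zprev (n : ℕ) : H := prev (S.x 0) S.z n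

/-- `p (n - 1)`, with `p (-1) = x 0`. -/
def pprev (n : ℕ) : H := prev (S.x 0) S.p n

/-- The residual vector in the first term of `ℓ n`. -/
def residual (n : ℕ) : H :=
  S.p n - S.x n + P.α n • (S.x n - S.pprev n)
    + (P.γ n * P.βbar * P.lam n ^ 2 / P.θhat n) • S.u n
    - (2 * P.θbar n / P.θ n) • S.v n

/-- The safeguarding quantity `ℓ n`. -/
def ell (n : ℕ) : ℝ :=
  P.θ n / 2 * mNorm M (S.residual P n) ^ 2
    + 2 * P.μ n * P.γ n *
        mInner M ((1 / P.γ n) • (S.z n - S.p n) - (1 / P.γprev n) • (S.zprev n - S.pprev n))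
          (S.p n - S.pprev n)
    + P.μ n * P.γ n * P.βbar / 2 *
        mNorm M (S.p n - S.y n - (S.pprev n - S.yprev n)) ^ 2

/-- The quantity `φ n` associated with the point `xs`. -/
def phi (xs : H) (n : ℕ) : ℝ :=
  mInner M ((1 / P.γ n) • (S.z n - S.p n)) (S.p n - xs)
    + P.βbar / 4 * mNorm M (S.y n - S.p n) ^ 2

/-- The Lyapunov sequence `V n` associated with the point `xs`. -/
def V (xs : H) : ℕ → ℝ
  | 0 => mNorm M (S.x 0 - xs) ^ 2
  | n + 1 => mNorm M (S.x (n + 1) - xs) ^ 2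
      + 2 * P.lam (n + 1) * P.γ (n + 1) * P.α (n + 1) * S.phi P M xs n + S.ell P M n

/-- `S` is generated by the algorithm with metric `M`, operators `A`, `C` and parameters `P`,
from the initial point `S.x 0`. The deviations are any vectors meeting the safeguard. -/
structure IsGenerated (A : H → Set H) (C : H → H) : Prop where
  u_zero : S.u 0 = 0
  v_zero : S.v 0 = 0
  y_eq : ∀ n, S.y n = S.x n + P.α n • (S.yprev n - S.x n) + S.u n
  z_eq : ∀ n, S.z n = S.x n + P.α n • (S.pprev n - S.x n)
    + P.αbar n • (S.zprev n - S.pprev n)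
    + (P.θbar n * P.γ n * P.βbar / P.θhat n) • S.u n + S.v n
  p_mem : ∀ n, S.p n ∈ setInverse (metricPlus M (P.γ n) A) (M (S.z n) - P.γ n • C (S.y n))
  x_succ : ∀ n, S.x (n + 1) = S.x n + P.lam n • (S.p n - S.z n)
    + (P.αbar n * P.lam n) • (S.zprev n - S.pprev n)
  safeguard : ∀ n,
    (P.lam (n + 1) + P.μ (n + 1)) *
        (P.θtilde (n + 1) / P.θhat (n + 1) * mNorm M (S.u (n + 1)) ^ 2
          + P.θhat (n + 1) / P.θ (n + 1) * mNorm M (S.v (n + 1)) ^ 2)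
      ≤ P.ζ (n + 1) * S.ell P M n

end Iterates

/-- Weak convergence of a sequence in `H`. -/
def WeaklyConverges (s : ℕ → H) (a : H) : Prop :=
  Tendsto (fun n => toWeakSpace ℝ H (s n)) atTop (𝓝 (toWeakSpace ℝ H a))

end MomentumFB

end

open MomentumFB

/-!
The argument is a Lyapunov analysis. Put `d n = p n - x n - α n • (p (n - 1) - x n)`. The step of
the method is `x (n + 1) = x n + lam n • D n`, where `D n` is `d n` corrected by multiples of the
deviations `u n` and `v n`, and the residual in `ℓ n` is another such correction of `d n`. In these
vectors the quantities `φ n`, `φ (n - 1)`, `ℓ n` and the two squared distances to the zero `xs`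
satisfy an exact balance (`Iterates.IsGenerated.lyapunov_identity`): the terms with history cancel
or complete a square (`IsStronglyPositive.step_identity`), and what is left is a quadratic identity
in `d n`, `u n`, `v n` that forces the coefficients `θ`, `θ̂`, `θ̄`, `θ̃`
(`IsStronglyPositive.deviation_identity`).

Inequalities enter at two places only. Monotonicity of `A` and cocoercivity of `C` give
`InclusionAssumption.two_point`, hence `φ n ≥ 0` and `ℓ n ≥ 0`; the safeguard and the growth
condition on `γ n * lam n` turn the balance into
`V (n + 1) + 2 * ε₁ * φ n + ε₀ * ℓ (n - 1) ≤ V n` (`Iterates.IsGenerated.descent`).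
Convergence of `V`, the rate for the residual and the summability claims follow from this, and
since the coefficients in the safeguard and in the residual are bounded above and away from zero,
the scaled deviations and `x (n + 1) - x n` vanish.

For weak convergence, the distances of `x n` to all zeros converge
(`Iterates.IsGenerated.tendsto_dist`), and weak limits of `p n` along ultrafilters are zeros
(`InclusionAssumption.mem_zer_of_isWeakLimit`). The latter avoids maximality of `A + C`: comparison
with one known zero makes `C (y n)` converge strongly. Opial's lemma
(`IsStronglyPositive.opial`) concludes. For constant relaxation parameters the momentum vanishes,
and the vanishing of residual and deviations supplies the hypotheses of the bounded case.
-/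

namespace MomentumFB

variable {H : Type*} [NormedAddCommGroup H] [InnerProductSpace ℝ H]

/-! ### The metric induced by a strongly positive operator -/

section Metric

variable (M : H →L[ℝ] H)

theorem mInner_add_left (a b c : H) : mInner M (a + b) c = mInner M a c + mInner M b c := by
  simp [mInner, inner_add_left]

theorem mInner_add_right (a b c : H) : mInner M a (b + c) = mInner M a b + mInner M a c := by
  simp [mInner, inner_add_right]

theorem mInner_sub_left (a b c : H) : mInner M (a - b) c = mInner M a c - mInner M b c := by
  simp [mInner, inner_sub_left]

theorem mInner_sub_right (a b c : H) : mInner M a (b - c) = mInner M a b - mInner M a c := by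
  simp [mInner, inner_sub_right]

theorem mInner_smul_left (r : ℝ) (a b : H) : mInner M (r • a) b = r * mInner M a b := by
  simp [mInner, inner_smul_left]

theorem mInner_smul_right (r : ℝ) (a b : H) : mInner M a (r • b) = r * mInner M a b := by
  simp [mInner, inner_smul_right]

variable [CompleteSpace H] {M}

theorem IsStronglyPositive.mInner_comm (hM : IsStronglyPositive M) (a b : H) :
    mInner M a b = mInner M b a := by
  have h := hM.1.isSymmetric a b
  simp only [mInner, ContinuousLinearMap.coe_coe] at *
  rw [← h, real_inner_comm]

theorem IsStronglyPositive.mInner_self_nonneg (hM : IsStronglyPositive M) (a : H) :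
    0 ≤ mInner M a a := by
  obtain ⟨-, c, hc, h⟩ := hM
  exact le_trans (by positivity) (h a)

theorem IsStronglyPositive.mNorm_sq (hM : IsStronglyPositive M) (a : H) :
    mNorm M a ^ 2 = mInner M a a :=
  Real.sq_sqrt (hM.mInner_self_nonneg a)

theorem IsStronglyPositive.mNorm_smul_sq (hM : IsStronglyPositive M) (r : ℝ) (a : H) :
    mNorm M (r • a) ^ 2 = r ^ 2 * mNorm M a ^ 2 := by
  rw [hM.mNorm_sq, hM.mNorm_sq, mInner_smul_left, mInner_smul_right]
  ring

/-- The `M`-norm dominates the original norm, so convergence to `0` can be tested on it. -/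
theorem IsStronglyPositive.tendsto_zero (hM : IsStronglyPositive M) {s : ℕ → H}
    (hs : Tendsto (fun n => mNorm M (s n) ^ 2) atTop (𝓝 0)) : Tendsto s atTop (𝓝 0) := by
  obtain ⟨-, c, hc, h⟩ := id hM
  have h1 : Tendsto (fun n => ‖s n‖ ^ 2) atTop (𝓝 0) := by
    have h2 := hs.const_mul c⁻¹
    rw [mul_zero] at h2
    refine squeeze_zero (fun n => by positivity) (fun n => ?_) h2
    rw [hM.mNorm_sq, inv_mul_eq_div, le_div_iff₀ hc, mul_comm]
    exact h (s n)
  have h3 := h1.sqrt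
  simp only [Real.sqrt_sq (norm_nonneg _), Real.sqrt_zero] at h3
  exact tendsto_zero_iff_norm_tendsto_zero.2 h3

/-- Cocoercivity written for the preimage `e` of `C x - C y` under `M`, which removes `M.inverse`. -/
theorem IsCocoercive.exists_mInner (hM : IsStronglyPositive M) {β : ℝ} {C : H → H}
    (hC : IsCocoercive M β C) (x y : H) :
    ∃ e : H, C x - C y = M e ∧ mInner M e e ≤ β * mInner M e (x - y) := by
  have hinv : M (M.inverse (C x - C y)) = C x - C y :=
    hM.isInvertible.self_apply_inverse _
  refine ⟨M.inverse (C x - C y), hinv.symm, ?_⟩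
  have h := hC x y
  have hq : inner ℝ (C x - C y) (M.inverse (C x - C y)) =
      mInner M (M.inverse (C x - C y)) (M.inverse (C x - C y)) := by
    rw [mInner, hinv, real_inner_comm]
  rw [mNorm, hq, Real.sq_sqrt (hM.mInner_self_nonneg _)] at h
  have hr : mInner M (M.inverse (C x - C y)) (x - y) = inner ℝ (C x - C y) (x - y) := by
    rw [hM.mInner_comm, mInner, hinv, real_inner_comm]
  rwa [hr]

/-- Cocoercivity in the metric of `M` yields cocoercivity in the metric of `H`. -/
theorem IsCocoercive.exists_sq_norm_le (hM : IsStronglyPositive M) {β : ℝ} (hβ : 0 ≤ β)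
    {C : H → H} (hC : IsCocoercive M β C) :
    ∃ K : ℝ, 0 ≤ K ∧ ∀ x y : H, ‖C x - C y‖ ^ 2 ≤ K * inner ℝ (C x - C y) (x - y) := by
  obtain ⟨-, c, hc, h⟩ := id hM
  refine ⟨‖M‖ ^ 2 * β / c, by positivity, fun x y => ?_⟩
  obtain ⟨e, he, hle⟩ := hC.exists_mInner hM x y
  have h1 : ‖C x - C y‖ ≤ ‖M‖ * ‖e‖ := he ▸ M.le_opNorm e
  have h2 : ‖C x - C y‖ ^ 2 ≤ ‖M‖ ^ 2 * ‖e‖ ^ 2 := by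
    rw [← mul_pow]
    gcongr
  have h3 : c * ‖e‖ ^ 2 ≤ β * inner ℝ (C x - C y) (x - y) := by
    rw [he, real_inner_comm]
    rw [hM.mInner_comm e (x - y)] at hle
    exact (h e).trans hle
  rw [div_mul_eq_mul_div, le_div_iff₀ hc]
  calc ‖C x - C y‖ ^ 2 * c ≤ ‖M‖ ^ 2 * ‖e‖ ^ 2 * c := by gcongr
    _ = ‖M‖ ^ 2 * (c * ‖e‖ ^ 2) := by ring
    _ ≤ ‖M‖ ^ 2 * (β * inner ℝ (C x - C y) (x - y)) := by gcongr
    _ = _ := by ring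

/-- The interpolation inequality: monotonicity of `A` and cocoercivity of `C`, combined by
completing the square. With the second point a zero of `A + C` it gives nonnegativity of `φ n`,
with two consecutive iterates it gives nonnegativity of the last two terms of `ℓ n`. -/
theorem InclusionAssumption.two_point {β : ℝ} {A : H → Set H} {C : H → H}
    (h : InclusionAssumption M β A C) {w₁ w₂ y₁ y₂ p₁ p₂ : H}
    (h₁ : M w₁ - C y₁ ∈ A p₁) (h₂ : M w₂ - C y₂ ∈ A p₂) :
    0 ≤ mInner M (w₁ - w₂) (p₁ - p₂)
      + β / 4 * mNorm M (p₁ - y₁ - (p₂ - y₂)) ^ 2 := by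
  have hM := h.metric
  obtain ⟨e, he, hle⟩ := h.cocoercive.exists_mInner hM y₁ y₂
  have hmono : 0 ≤ mInner M (w₁ - w₂ - e) (p₁ - p₂) := by
    have := h.maximal.1 (p₁, _) h₁ (p₂, _) h₂
    rw [hM.mInner_comm, mInner, real_inner_comm, map_sub, map_sub, ← he]
    convert this using 2
    simp only
    abel
  set q := p₁ - y₁ - (p₂ - y₂) with hq
  have hp : p₁ - p₂ = q + (y₁ - y₂) := by rw [hq]; abel
  rw [hM.mNorm_sq]
  have hsplit : mInner M (w₁ - w₂ - e) (p₁ - p₂) =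
      mInner M (w₁ - w₂) (p₁ - p₂) - mInner M e q - mInner M e (y₁ - y₂) := by
    rw [mInner_sub_left M (w₁ - w₂) e, hp]
    simp only [mInner_add_right]
    ring
  rcases h.beta_nonneg.eq_or_lt with hβ | hβ
  · -- for `β = 0` the operator `C` is constant
    have he0 : e = 0 := by
      obtain ⟨-, c, hc, hcM⟩ := hM
      have h1 := hcM e
      rw [← hβ, zero_mul] at hle
      have h2 : c * ‖e‖ ^ 2 ≤ 0 := h1.trans hle
      have h3 : ‖e‖ ^ 2 ≤ 0 := nonpos_of_mul_nonpos_right h2 hc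
      simpa using le_antisymm h3 (by positivity)
    rw [he0, sub_zero] at hmono
    rw [← hβ]
    simpa using hmono
  · have hsq := hM.mInner_self_nonneg (e + (β / 2) • q)
    simp only [mInner_add_left, mInner_add_right, mInner_smul_left, mInner_smul_right,
      hM.mInner_comm q e] at hsq
    have : 0 ≤ β * (mInner M e q + mInner M e (y₁ - y₂) + β / 4 * mInner M q q) := by
      nlinarith
    have := nonneg_of_mul_nonneg_right this hβ
    linarith

end Metric

/-! ### Quadratic identities behind the Lyapunov equality -/

section Identity

variable [CompleteSpace H] {M : H →L[ℝ] H}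

/-- The core of the Lyapunov identity, in which only the vector
`d = p n - x n - α n • (p (n - 1) - x n)` and the deviations `u`, `v` remain. Here `L` stands for
`λ n + μ n` and `g` for `γ n * β̄`. -/
theorem IsStronglyPositive.deviation_identity (hM : IsStronglyPositive M) (d u v : H)
    {l L g θ θh θb : ℝ} (hθ : θ ≠ 0) (hθh : θh ≠ 0)
    (eθ : θ = (4 - g) * L - 2 * l ^ 2) (eθh : θh = 2 * L - g * l ^ 2) (eθb : θb = L - l ^ 2) :
    l ^ 2 * mNorm M (d - (θb * g / θh) • u - v) ^ 2
        - 2 * L * mInner M (d - (θb * g / θh) • u - v) d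
        + g * L / 2 * mNorm M (u - d) ^ 2
        + θ / 2 * mNorm M (d + (g * l ^ 2 / θh) • u - (2 * θb / θ) • v) ^ 2
      = L * (L * g / θh * mNorm M u ^ 2 + θh / θ * mNorm M v ^ 2) := by
  simp only [hM.mNorm_sq, mInner_add_left, mInner_add_right, mInner_sub_left, mInner_sub_right,
    mInner_smul_left, mInner_smul_right, hM.mInner_comm u d, hM.mInner_comm v d,
    hM.mInner_comm v u]
  generalize mInner M d d = dd
  generalize mInner M u u = uu
  generalize mInner M v v = vv
  generalize mInner M d u = du
  generalize mInner M d v = dv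
  generalize mInner M u v = uv
  have hdd : l ^ 2 - 2 * L + g * L / 2 + θ / 2 = 0 := by rw [eθ]; ring
  have hdu : -2 * l ^ 2 * (θb * g / θh) + 2 * L * (θb * g / θh) - g * L + θ * (g * l ^ 2 / θh)
      = 0 := by
    field_simp
    rw [eθ, eθh, eθb]; ring
  have hdv : -2 * l ^ 2 + 2 * L - θ * (2 * θb / θ) = 0 := by
    field_simp
    rw [eθb]; ring
  have huu : l ^ 2 * (θb * g / θh) ^ 2 + g * L / 2 + θ / 2 * (g * l ^ 2 / θh) ^ 2
      - L * (L * g / θh) = 0 := by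
    field_simp
    rw [eθ, eθh, eθb]; ring
  have hvv : l ^ 2 + θ / 2 * (2 * θb / θ) ^ 2 - L * (θh / θ) = 0 := by
    field_simp
    rw [eθ, eθh, eθb]; ring
  have huv : 2 * l ^ 2 * (θb * g / θh) - θ * (g * l ^ 2 / θh) * (2 * θb / θ) = 0 := by
    field_simp
    ring
  linear_combination dd * hdd + du * hdu + dv * hdv + uu * huu + vv * hvv + uv * huv

/-- One step of the method written in the vectors `d` and `D = (x (n + 1) - x n) / λ n`: here
`p'`, `w'`, `t'` stand for `p (n - 1)`, `(z (n - 1) - p (n - 1)) / γ (n - 1)` and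
`y (n - 1) - p (n - 1)`. -/
theorem IsStronglyPositive.step_identity (hM : IsStronglyPositive M) (x xs p p' w' t' d D u : H)
    {l m a γ b : ℝ} (hl : l = (1 - a) * (l + m))
    (hd : d = p - x - a • (p' - x)) :
    mNorm M (x + l • D - xs) ^ 2
        + 2 * l * (mInner M ((γ * a) • w' - D) (p - xs)
          + γ * b / 4 * mNorm M (a • t' - d + u) ^ 2)
        + (2 * m * mInner M ((γ * a) • w' - D - γ • w') (p - p')
          + m * (γ * b) / 2 * mNorm M (t' - (a • t' - d + u)) ^ 2)
      = mNorm M (x - xs) ^ 2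
        + 2 * l * γ * a * (mInner M w' (p' - xs) + b / 4 * mNorm M t' ^ 2)
        + (l ^ 2 * mNorm M D ^ 2 - 2 * (l + m) * mInner M D d
          + γ * b * (l + m) / 2 * mNorm M (u - d) ^ 2) := by
  obtain ⟨L, hL⟩ : ∃ L, L = l + m := ⟨_, rfl⟩
  obtain rfl : m = L - l := by linarith
  rw [← hL] at hl
  subst hl hd
  simp only [hM.mNorm_sq, mInner_add_left, mInner_add_right, mInner_sub_left, mInner_sub_right,
    mInner_smul_left, mInner_smul_right]
  simp only [hM.mInner_comm p x, hM.mInner_comm p' x, hM.mInner_comm xs x, hM.mInner_comm D x,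
    hM.mInner_comm t' x, hM.mInner_comm u x, hM.mInner_comm p' p, hM.mInner_comm xs D,
    hM.mInner_comm t' p, hM.mInner_comm u p, hM.mInner_comm t' p', hM.mInner_comm u p',
    hM.mInner_comm u t']
  ring

end Identity

/-! ### Elementary consequences of the recursion -/

section Algorithm

variable {M : H →L[ℝ] H} {A : H → Set H} {C : H → H} {β : ℝ} {P : Params} {S : Iterates H}

theorem Params.Admissible.γprev_pos (hP : P.Admissible β) : ∀ n, 0 < P.γprev n
  | 0 => hP.γ_pos 0
  | n + 1 => hP.γ_pos n

theorem Params.Admissible.add_pos (hP : P.Admissible β) (n : ℕ) : 0 < P.lam n + P.μ n :=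
  add_pos_of_pos_of_nonneg (hP.lam_pos n) (hP.μ_nonneg n)

theorem Params.Admissible.α_nonneg (hP : P.Admissible β) (n : ℕ) : 0 ≤ P.α n :=
  div_nonneg (hP.μ_nonneg n) (hP.add_pos n).le

theorem mem_zer_iff {H : Type*} [NormedAddCommGroup H] {A : H → Set H} {C : H → H}
    {x : H} : x ∈ zer (addSingle A C) ↔ -C x ∈ A x := by
  constructor
  · rintro ⟨a, ha, h⟩
    rwa [← eq_neg_of_add_eq_zero_left h.symm]
  · exact fun h => ⟨_, h, by simp⟩

/-- With `φ (-1) = 0`, the formula defining `φ n` extends to the index `-1`. -/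
theorem Iterates.prev_phi (S : Iterates H) (P : Params) (M : H →L[ℝ] H) (xs : H) (n : ℕ) :
    prev 0 (S.phi P M xs) n =
      mInner M ((1 / P.γprev n) • (S.zprev n - S.pprev n)) (S.pprev n - xs)
        + P.βbar / 4 * mNorm M (S.yprev n - S.pprev n) ^ 2 := by
  cases n with
  | zero => simp [prev, Iterates.zprev, Iterates.pprev, Iterates.yprev, mInner, mNorm]
  | succ n => rfl

/-- A formula for `V n` that covers the index `0` as well, with `φ (-1) = ℓ (-1) = 0`. -/
theorem Iterates.V_eq (S : Iterates H) (P : Params) (M : H →L[ℝ] H) (xs : H) (n : ℕ) :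
    S.V P M xs n = mNorm M (S.x n - xs) ^ 2
      + 2 * P.lam n * P.γ n * P.α n * prev 0 (S.phi P M xs) n + prev 0 (S.ell P M) n := by
  cases n with
  | zero => simp [prev, Iterates.V]
  | succ n => rfl

/-- The momentum terms in `z n` and `x (n + 1)` cancel, so that the increment of the method depends
on `z (n - 1)` only through `p n`. -/
theorem Iterates.IsGenerated.x_succ_eq (hS : S.IsGenerated P M A C) (n : ℕ) :
    S.x (n + 1) = S.x n + P.lam n • (S.p n - S.x n - P.α n • (S.pprev n - S.x n)
      - (P.θbar n * (P.γ n * P.βbar) / P.θhat n) • S.u n - S.v n) := by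
  rw [hS.x_succ n, hS.z_eq n, ← mul_assoc (P.θbar n)]
  module

/-- The forward--backward step, read as an inclusion for `A`. -/
theorem Iterates.IsGenerated.mem (hS : S.IsGenerated P M A C) (hP : P.Admissible β) (n : ℕ) :
    M ((1 / P.γ n) • (S.z n - S.p n)) - C (S.y n) ∈ A (S.p n) := by
  have hγ := (hP.γ_pos n).ne'
  obtain ⟨a, ha, he⟩ := hS.p_mem n
  have : M ((1 / P.γ n) • (S.z n - S.p n)) - C (S.y n) = a := by
    have h1 : P.γ n • a = M (S.z n) - P.γ n • C (S.y n) - M (S.p n) := by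
      rw [he]
      abel
    have h2 : a = (1 / P.γ n) • (P.γ n • a) := by
      rw [smul_smul, one_div_mul_cancel hγ, one_smul]
    rw [h2, h1, map_smul, map_sub, smul_sub, smul_sub, smul_sub, smul_smul, one_div_mul_cancel hγ,
      one_smul]
    abel
  rwa [this]

/-- The safeguard, extended to the index `0`, where there are no deviations. -/
theorem Iterates.IsGenerated.safeguard_prev (hS : S.IsGenerated P M A C) (n : ℕ) :
    (P.lam n + P.μ n) * (P.θtilde n / P.θhat n * mNorm M (S.u n) ^ 2
        + P.θhat n / P.θ n * mNorm M (S.v n) ^ 2) ≤ P.ζ n * prev 0 (S.ell P M) n := by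
  cases n with
  | zero => simp [hS.u_zero, hS.v_zero, mNorm, prev]
  | succ n => exact hS.safeguard n

end Algorithm

/-! ### The Lyapunov identity -/

section Lyapunov

variable [CompleteSpace H] {M : H →L[ℝ] H} {A : H → Set H} {C : H → H} {β : ℝ}
  {P : Params} {S : Iterates H}

/-- The Lyapunov identity: the exact balance of one step of the method, before any inequality
is used. -/
theorem Iterates.IsGenerated.lyapunov_identity (hS : S.IsGenerated P M A C)
    (hM : IsStronglyPositive M) (hP : P.Admissible β) (xs : H) {n : ℕ}
    (hθ : P.θ n ≠ 0) (hθh : P.θhat n ≠ 0) :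
    mNorm M (S.x (n + 1) - xs) ^ 2 + 2 * P.γ n * P.lam n * S.phi P M xs n + S.ell P M n
      = mNorm M (S.x n - xs) ^ 2
        + 2 * P.lam n * P.γ n * P.α n * prev 0 (S.phi P M xs) n
        + (P.lam n + P.μ n) *
          (P.θtilde n / P.θhat n * mNorm M (S.u n) ^ 2
            + P.θhat n / P.θ n * mNorm M (S.v n) ^ 2) := by
  have hγ := (hP.γ_pos n).ne'
  have hγ' := (hP.γprev_pos n).ne'
  have hL := (hP.add_pos n).ne'
  set d := S.p n - S.x n - P.α n • (S.pprev n - S.x n) with hd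
  set D := d - (P.θbar n * (P.γ n * P.βbar) / P.θhat n) • S.u n - S.v n with hD
  set w' := (1 / P.γprev n) • (S.zprev n - S.pprev n) with hw'
  set t' := S.yprev n - S.pprev n with ht'
  have hzp : S.z n - S.p n = (P.γ n * P.α n) • w' - D := by
    have hs : P.αbar n • (S.zprev n - S.pprev n) = (P.γ n * P.α n) • w' := by
      rw [hw', smul_smul]
      congr 1
      simp only [Params.αbar, Params.α]
      field_simp
    rw [hS.z_eq n, hs, hD, hd, ← mul_assoc (P.θbar n)]
    module
  have hyp : S.y n - S.p n = P.α n • t' - d + S.u n := by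
    rw [hS.y_eq n, ht', hd]
    module
  have hpy : S.p n - S.y n - (S.pprev n - S.yprev n) = t' - (P.α n • t' - d + S.u n) := by
    rw [← hyp, ht']
    abel
  have hr : S.residual P n = d + (P.γ n * P.βbar * P.lam n ^ 2 / P.θhat n) • S.u n
      - (2 * P.θbar n / P.θ n) • S.v n := by
    rw [Iterates.residual, hd]
    module
  have hφ : P.γ n * S.phi P M xs n = mInner M ((P.γ n * P.α n) • w' - D) (S.p n - xs)
      + P.γ n * P.βbar / 4 * mNorm M (P.α n • t' - d + S.u n) ^ 2 := by
    rw [Iterates.phi, hzp, hyp, mInner_smul_left]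
    field_simp
  have hℓ : S.ell P M n = P.θ n / 2 * mNorm M (d + (P.γ n * P.βbar * P.lam n ^ 2 / P.θhat n) •
        S.u n - (2 * P.θbar n / P.θ n) • S.v n) ^ 2
      + (2 * P.μ n * mInner M ((P.γ n * P.α n) • w' - D - P.γ n • w') (S.p n - S.pprev n)
        + P.μ n * (P.γ n * P.βbar) / 2 * mNorm M (t' - (P.α n • t' - d + S.u n)) ^ 2) := by
    rw [Iterates.ell, hr, hpy, hzp, ← hw', mInner_sub_left, mInner_smul_left,
      mInner_sub_left M ((P.γ n * P.α n) • w' - D), mInner_smul_left M (P.γ n) w']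
    field_simp
    ring
  have hl : P.lam n = (1 - P.α n) * (P.lam n + P.μ n) := by
    rw [Params.α]
    field_simp
    ring
  have h1 := hM.deviation_identity d (S.u n) (S.v n) (l := P.lam n) (L := P.lam n + P.μ n)
    (g := P.γ n * P.βbar) (θb := P.θbar n) hθ hθh rfl (by rw [Params.θhat]; ring) rfl
  have h2 := hM.step_identity (S.x n) xs (S.p n) (S.pprev n) w' t' d D (S.u n) (γ := P.γ n)
    (b := P.βbar) hl hd
  have hx : S.x (n + 1) = S.x n + P.lam n • D := hS.x_succ_eq n
  have hθt : P.θtilde n = (P.lam n + P.μ n) * (P.γ n * P.βbar) := mul_assoc _ _ _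
  rw [← hD] at h1
  rw [S.prev_phi, hx, hℓ, hθt]
  linear_combination h1 + h2 + 2 * P.lam n * hφ

end Lyapunov

/-! ### The scalar parameters -/

section Parameters

variable {β ε ε₀ ε₁ : ℝ} {P : Params}

theorem Params.Assumption.add_eq (h : P.Assumption β ε ε₀ ε₁) (n : ℕ) :
    P.lam n + P.μ n = P.lam n ^ 2 / P.lam 0 := by
  rw [h.μ_eq]
  ring

theorem Params.Assumption.α_eq (h : P.Assumption β ε ε₀ ε₁) {n : ℕ} (hn : 0 < P.lam n) :
    P.α n = 1 - P.lam 0 / P.lam n := by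
  have := h.lam_zero_pos
  rw [Params.α, h.add_eq, h.μ_eq]
  field_simp

theorem Params.Assumption.θ_eq (h : P.Assumption β ε ε₀ ε₁) (n : ℕ) :
    P.θ n = P.lam n ^ 2 / P.lam 0 * (4 - P.γ n * P.βbar - 2 * P.lam 0) := by
  have := h.lam_zero_pos
  rw [Params.θ, h.add_eq]
  field_simp

theorem Params.Assumption.θhat_eq (h : P.Assumption β ε ε₀ ε₁) (n : ℕ) :
    P.θhat n = P.lam n ^ 2 / P.lam 0 * (2 - P.γ n * P.βbar * P.lam 0) := by
  have := h.lam_zero_pos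
  rw [Params.θhat, ← mul_add, h.add_eq]
  field_simp

theorem Params.Assumption.θbar_eq (h : P.Assumption β ε ε₀ ε₁) (n : ℕ) :
    P.θbar n = P.lam n ^ 2 / P.lam 0 * (1 - P.lam 0) := by
  have := h.lam_zero_pos
  rw [Params.θbar, h.add_eq]
  field_simp

theorem Params.Assumption.ε_le (h : P.Assumption β ε ε₀ ε₁) (n : ℕ) :
    ε ≤ 4 - P.γ n * P.βbar - 2 * P.lam 0 := by
  linarith [h.γ_mul_le n]

theorem Params.Assumption.lam_zero_lt (h : P.Assumption β ε ε₀ ε₁) : P.lam 0 < 2 := by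
  linarith [h.γ_mul_le 0, h.le_γ_mul 0, h.ε_pos]

theorem Params.Assumption.γ_mul_lt (h : P.Assumption β ε ε₀ ε₁) (n : ℕ) :
    P.γ n * P.βbar < 4 := by
  linarith [h.γ_mul_le n, h.ε_pos, h.lam_zero_pos]

/-- The factor of `θ̂ n` is bounded away from `0`, because
`2 - (4 - 2 * lam 0 - ε) * lam 0 = 2 * (1 - lam 0) ^ 2 + ε * lam 0`. -/
theorem Params.Assumption.ε_mul_le (h : P.Assumption β ε ε₀ ε₁) (n : ℕ) :
    ε * P.lam 0 ≤ 2 - P.γ n * P.βbar * P.lam 0 := by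
  nlinarith [mul_le_mul_of_nonneg_right (h.γ_mul_le n) h.lam_zero_pos.le,
    sq_nonneg (1 - P.lam 0)]

theorem Params.Assumption.θ_pos (h : P.Assumption β ε ε₀ ε₁) {n : ℕ} (hn : 0 < P.lam n) :
    0 < P.θ n := by
  have := h.lam_zero_pos
  have := h.ε_pos.trans_le (h.ε_le n)
  rw [h.θ_eq]
  positivity

theorem Params.Assumption.θhat_pos (h : P.Assumption β ε ε₀ ε₁) {n : ℕ} (hn : 0 < P.lam n) :
    0 < P.θhat n := by
  have := h.lam_zero_pos
  have := (mul_pos h.ε_pos h.lam_zero_pos).trans_le (h.ε_mul_le n)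
  rw [h.θhat_eq]
  positivity

theorem Params.Assumption.βbar_pos (h : P.Assumption β ε ε₀ ε₁) (hP : P.Admissible β) :
    0 < P.βbar :=
  pos_of_mul_pos_right (h.ε_pos.trans_le (h.le_γ_mul 0)) (hP.γ_pos 0).le

theorem Params.Assumption.γ_le (h : P.Assumption β ε ε₀ ε₁) (hP : P.Admissible β) (n : ℕ) :
    P.γ n ≤ 4 / P.βbar :=
  (le_div_iff₀ (h.βbar_pos hP)).2 (h.γ_mul_lt n).le

theorem Params.Assumption.le_γ (h : P.Assumption β ε ε₀ ε₁) (hP : P.Admissible β) (n : ℕ) :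
    ε / P.βbar ≤ P.γ n :=
  (div_le_iff₀ (h.βbar_pos hP)).2 (h.le_γ_mul n)

end Parameters

/-! ### Nonnegativity and descent -/

section Descent

variable [CompleteSpace H] {M : H →L[ℝ] H} {A : H → Set H} {C : H → H} {β ε ε₀ ε₁ : ℝ}
  {P : Params} {S : Iterates H}

/-- Nonnegativity of `φ n` with a quantitative margin: the part of `β̄` exceeding `β` is not needed
by the interpolation inequality. -/
theorem Iterates.IsGenerated.le_phi (hS : S.IsGenerated P M A C)
    (hAC : InclusionAssumption M β A C) (hP : P.Admissible β) {xs : H}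
    (hxs : xs ∈ zer (addSingle A C)) (n : ℕ) :
    (P.βbar - β) / 4 * mNorm M (S.y n - S.p n) ^ 2 ≤ S.phi P M xs n := by
  have h := hAC.two_point (hS.mem hP n) (w₂ := 0) (y₂ := xs) (p₂ := xs)
    (by simpa using mem_zer_iff.1 hxs)
  have hn : mNorm M (S.p n - S.y n) = mNorm M (S.y n - S.p n) := by
    rw [← neg_sub, mNorm, mNorm, map_neg, inner_neg_neg]
  rw [sub_zero, sub_self, sub_zero, hn] at h
  rw [Iterates.phi]
  linarith

theorem Iterates.IsGenerated.phi_nonneg (hS : S.IsGenerated P M A C)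
    (hAC : InclusionAssumption M β A C) (hP : P.Admissible β) {xs : H}
    (hxs : xs ∈ zer (addSingle A C)) (n : ℕ) : 0 ≤ S.phi P M xs n := by
  have := hP.beta_le
  exact le_trans (mul_nonneg (by linarith) (by positivity)) (hS.le_phi hAC hP hxs n)

theorem Iterates.IsGenerated.le_ell (hS : S.IsGenerated P M A C)
    (hAC : InclusionAssumption M β A C) (hP : P.Admissible β)
    (h : P.Assumption β ε ε₀ ε₁) (n : ℕ) :
    P.θ n / 2 * mNorm M (S.residual P n) ^ 2 ≤ S.ell P M n := by
  cases n with
  | zero =>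
    -- there is no momentum in the first step
    have hμ : P.μ 0 = 0 := by
      have := h.lam_zero_pos
      rw [h.μ_eq]
      field_simp
      ring
    simp [Iterates.ell, hμ]
  | succ n =>
    have h1 := hAC.two_point (hS.mem hP (n + 1)) (hS.mem hP n)
    have h2 := mul_nonneg (mul_nonneg (mul_nonneg zero_le_two (hP.μ_nonneg (n + 1)))
      (hP.γ_pos (n + 1)).le) h1
    have h3 : 0 ≤ 2 * P.μ (n + 1) * P.γ (n + 1) * ((P.βbar - β) / 4 *
        mNorm M (S.p (n + 1) - S.y (n + 1) - (S.p n - S.y n)) ^ 2) := by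
      have := hP.μ_nonneg (n + 1)
      have := hP.γ_pos (n + 1)
      have := sub_nonneg.2 hP.beta_le
      positivity
    simp only [Iterates.ell, Params.γprev, Iterates.zprev, Iterates.pprev, Iterates.yprev, prev]
    linarith

theorem Iterates.IsGenerated.ell_nonneg (hS : S.IsGenerated P M A C)
    (hAC : InclusionAssumption M β A C) (hP : P.Admissible β)
    (h : P.Assumption β ε ε₀ ε₁) (n : ℕ) : 0 ≤ S.ell P M n := by
  have := h.θ_pos (hP.lam_pos n)
  exact le_trans (by positivity) (hS.le_ell hAC hP h n)

theorem Iterates.IsGenerated.prev_ell_nonneg (hS : S.IsGenerated P M A C)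
    (hAC : InclusionAssumption M β A C) (hP : P.Admissible β)
    (h : P.Assumption β ε ε₀ ε₁) : ∀ n, 0 ≤ prev 0 (S.ell P M) n
  | 0 => le_rfl
  | n + 1 => hS.ell_nonneg hAC hP h n

theorem Iterates.IsGenerated.prev_phi_nonneg (hS : S.IsGenerated P M A C)
    (hAC : InclusionAssumption M β A C) (hP : P.Admissible β) {xs : H}
    (hxs : xs ∈ zer (addSingle A C)) : ∀ n, 0 ≤ prev 0 (S.phi P M xs) n
  | 0 => le_rfl
  | n + 1 => hS.phi_nonneg hAC hP hxs n

/-- The descent inequality for the Lyapunov sequence. -/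
theorem Iterates.IsGenerated.descent (hS : S.IsGenerated P M A C)
    (hAC : InclusionAssumption M β A C) (hP : P.Admissible β)
    (h : P.Assumption β ε ε₀ ε₁) {xs : H} (hxs : xs ∈ zer (addSingle A C)) (n : ℕ) :
    S.V P M xs (n + 1) + 2 * ε₁ * S.phi P M xs n + ε₀ * prev 0 (S.ell P M) n
      ≤ S.V P M xs n := by
  have hid := hS.lyapunov_identity hAC.metric hP xs (h.θ_pos (hP.lam_pos n)).ne'
    (h.θhat_pos (hP.lam_pos n)).ne'
  have hsafe := hS.safeguard_prev n
  have hφ := hS.phi_nonneg hAC hP hxs n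
  have hζ := mul_le_mul_of_nonneg_right (h.ζ_le n) (hS.prev_ell_nonneg hAC hP h n)
  -- the left side is `γ (n + 1) * (lam (n + 1) - lam 0) + ε₁`: this is the growth condition
  have hco : P.lam (n + 1) * P.γ (n + 1) * P.α (n + 1) + ε₁ ≤ P.γ n * P.lam n := by
    have hl := (hP.lam_pos (n + 1)).ne'
    have hg := h.growth n
    have : P.lam (n + 1) * P.γ (n + 1) * P.α (n + 1)
        = P.γ (n + 1) * P.lam (n + 1) - P.γ (n + 1) * P.lam 0 := by
      rw [h.α_eq (hP.lam_pos (n + 1))]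
      field_simp
    linarith
  have hco' := mul_le_mul_of_nonneg_right hco hφ
  rw [S.V_eq P M xs n]
  simp only [Iterates.V]
  linarith

end Descent

/-! ### Weak limits along filters -/

section WeakLimits

/-- The weak limit of `s` along an arbitrary filter, tested on inner products. -/
def IsWeakLimit (F : Filter ℕ) (s : ℕ → H) (a : H) : Prop :=
  ∀ h : H, Tendsto (fun n => inner ℝ h (s n)) F (𝓝 (inner ℝ h a))

theorem IsWeakLimit.congr {F : Filter ℕ} {s t : ℕ → H} {a : H} (hs : IsWeakLimit F s a)
    (h : Tendsto (fun n => t n - s n) F (𝓝 0)) : IsWeakLimit F t a := by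
  intro w
  have h1 := (hs w).add ((tendsto_const_nhds (x := w)).inner (𝕜 := ℝ) h)
  simpa [inner_sub_right] using h1

/-- Inner products pass to the limit when one factor converges strongly, and the other one weakly
and boundedly. -/
theorem IsWeakLimit.tendsto_inner {F : Filter ℕ} {s t : ℕ → H} {a b : H}
    (hs : IsWeakLimit F s a) {R : ℝ} (hR : ∀ n, ‖s n‖ ≤ R) (ht : Tendsto t F (𝓝 b)) :
    Tendsto (fun n => inner ℝ (t n) (s n)) F (𝓝 (inner ℝ b a)) := by
  have h0 : Tendsto (fun n => inner ℝ (t n - b) (s n)) F (𝓝 0) := by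
    have h1 : Tendsto (fun n => ‖t n - b‖ * R) F (𝓝 0) := by
      simpa using (tendsto_iff_norm_sub_tendsto_zero.1 ht).mul_const R
    refine squeeze_zero_norm (fun n => ?_) h1
    exact (norm_inner_le_norm _ _).trans (by gcongr; exact hR n)
  have h2 := h0.add (hs b)
  simpa [inner_sub_left] using h2

variable [CompleteSpace H]

/-- Weak compactness of balls: a bounded sequence converges weakly along every ultrafilter. -/
theorem exists_isWeakLimit {s : ℕ → H} {R : ℝ} (hR : ∀ n, ‖s n‖ ≤ R) (U : Ultrafilter ℕ) :
    ∃ a, IsWeakLimit (U : Filter ℕ) s a := by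
  set f : ℕ → WeakDual ℝ H := fun n => StrongDual.toWeakDual (InnerProductSpace.toDual ℝ H (s n))
    with hf
  have hK := WeakDual.isCompact_closedBall (𝕜 := ℝ) (E := H) 0 R
  obtain ⟨g, -, hg⟩ := hK.ultrafilter_le_nhds (U.map f) (by
    rw [le_principal_iff]
    refine Filter.mem_map.2 (Filter.univ_mem' fun n => ?_)
    simpa [hf] using hR n)
  refine ⟨(InnerProductSpace.toDual ℝ H).symm (WeakDual.toStrongDual g), fun h => ?_⟩
  have h1 : Tendsto (fun n => f n h) U (𝓝 (g h)) :=
    ((WeakDual.eval_continuous h).tendsto g).comp hg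
  have h2 : inner ℝ h ((InnerProductSpace.toDual ℝ H).symm (WeakDual.toStrongDual g)) = g h := by
    rw [real_inner_comm, InnerProductSpace.toDual_symm_apply]
    rfl
  rw [h2]
  refine h1.congr fun n => ?_
  rw [real_inner_comm]
  rfl

theorem IsWeakLimit.weaklyConverges {s : ℕ → H} {a : H} (h : IsWeakLimit atTop s a) :
    WeaklyConverges s a := by
  refine (WeakBilin.tendsto_iff_forall_eval_tendsto _ ?_).2 fun f => ?_
  · intro x y hxy
    by_contra hne
    obtain ⟨f, hf⟩ := SeparatingDual.exists_separating_of_ne (R := ℝ) hne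
    exact hf (congrArg (fun φ => φ f) hxy)
  · have h1 := h ((InnerProductSpace.toDual ℝ H).symm f)
    simp only [InnerProductSpace.toDual_symm_apply] at h1
    exact h1

/-- Opial's lemma in the metric of `M`: if the `M`-distances of `s` to all points of `Z` converge
and all weak limits of `s` along ultrafilters lie in `Z`, then `s` converges weakly. -/
theorem IsStronglyPositive.opial {M : H →L[ℝ] H} (hM : IsStronglyPositive M) {s : ℕ → H} {R : ℝ}
    (hR : ∀ n, ‖s n‖ ≤ R) {Z : Set H}
    (hdist : ∀ a ∈ Z, ∃ L : ℝ, Tendsto (fun n => mNorm M (s n - a) ^ 2) atTop (𝓝 L))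
    (hZ : ∀ (U : Ultrafilter ℕ) (a : H), (U : Filter ℕ) ≤ atTop →
      IsWeakLimit (U : Filter ℕ) s a → a ∈ Z) :
    ∃ a ∈ Z, IsWeakLimit atTop s a := by
  have key : ∀ U₁ U₂ : Ultrafilter ℕ, (U₁ : Filter ℕ) ≤ atTop → (U₂ : Filter ℕ) ≤ atTop →
      ∀ a₁ a₂, IsWeakLimit (U₁ : Filter ℕ) s a₁ → IsWeakLimit (U₂ : Filter ℕ) s a₂ →
      a₁ = a₂ := by
    intro U₁ U₂ h₁ h₂ a₁ a₂ ha₁ ha₂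
    obtain ⟨L₁, hL₁⟩ := hdist a₁ (hZ U₁ a₁ h₁ ha₁)
    obtain ⟨L₂, hL₂⟩ := hdist a₂ (hZ U₂ a₂ h₂ ha₂)
    -- the difference of the squared distances is affine in `s n`
    have haff : ∀ n, inner ℝ (M (a₂ - a₁)) (s n)
        = (mNorm M (s n - a₁) ^ 2 - mNorm M (s n - a₂) ^ 2
          - (mInner M a₁ a₁ - mInner M a₂ a₂)) / 2 := by
      intro n
      have : inner ℝ (M (a₂ - a₁)) (s n) = mInner M (s n) (a₂ - a₁) := real_inner_comm _ _
      rw [this]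
      simp only [hM.mNorm_sq, mInner_sub_left, mInner_sub_right, hM.mInner_comm a₁ (s n),
        hM.mInner_comm a₂ (s n)]
      ring
    have hlim := ((hL₁.sub hL₂).sub_const (mInner M a₁ a₁ - mInner M a₂ a₂)).div_const 2
    simp only [← haff] at hlim
    have e₁ := tendsto_nhds_unique (hlim.mono_left h₁) (ha₁ (M (a₂ - a₁)))
    have e₂ := tendsto_nhds_unique (hlim.mono_left h₂) (ha₂ (M (a₂ - a₁)))
    obtain ⟨-, c, hc, h⟩ := id hM
    have h0 : inner ℝ (a₂ - a₁) (M (a₂ - a₁)) = 0 := by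
      rw [real_inner_comm, inner_sub_right, ← e₁, ← e₂, sub_self]
    have h3 : ‖a₂ - a₁‖ ^ 2 ≤ 0 := nonpos_of_mul_nonpos_right (h0 ▸ h (a₂ - a₁)) hc
    have h4 : ‖a₂ - a₁‖ = 0 := by simpa using le_antisymm h3 (by positivity)
    exact (sub_eq_zero.1 (norm_eq_zero.1 h4)).symm
  obtain ⟨U₀, hU₀⟩ := Ultrafilter.exists_le (atTop : Filter ℕ)
  obtain ⟨a, ha⟩ := exists_isWeakLimit hR U₀
  refine ⟨a, hZ U₀ a hU₀ ha, fun h => ?_⟩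
  rw [tendsto_iff_ultrafilter]
  intro U hU
  obtain ⟨b, hb⟩ := exists_isWeakLimit hR U
  rw [key U₀ U hU₀ hU a b ha hb]
  exact hb h

end WeakLimits

/-! ### Weak limits of approximate zeros -/

section Closedness

/-- A point that is monotonically related to the graph of a maximally monotone operator belongs to
it. -/
theorem IsMaximallyMonotone.mem_of_forall {A : H → Set H} (hA : IsMaximallyMonotone A) {a v : H}
    (h : ∀ q, ∀ b ∈ A q, 0 ≤ inner ℝ (v - b) (a - q)) : v ∈ A a := by
  by_contra hv
  refine hA.2 ⟨fun x => A x ∪ {w | x = a ∧ w = v}, ?_, ?_⟩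
  · rintro ⟨q, b⟩ hq ⟨r, c⟩ hr
    simp only [graph, Set.mem_ofPred_eq, Set.mem_union] at hq hr
    rcases hq with hq | ⟨rfl, rfl⟩ <;> rcases hr with hr | ⟨rfl, rfl⟩
    · exact hA.1 (q, b) hq (r, c) hr
    · have := h q b hq
      rw [← neg_sub, ← neg_sub _ q, inner_neg_neg]
      exact this
    · exact h r c hr
    · simp
  · refine ⟨fun q hq => Or.inl hq, fun hsub => hv ?_⟩
    exact hsub (show (a, v) ∈ graph _ from Or.inr ⟨rfl, rfl⟩)

variable [CompleteSpace H] {M : H →L[ℝ] H} {A : H → Set H} {C : H → H} {β : ℝ}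

/-- Weak limits of approximate zeros of `A + C` are zeros. Comparison with one known zero `xs`
shows that `C (y n)` converges strongly to `C xs`; therefore `-C xs ∈ A a` by maximality of `A`,
and `C a = C xs` by cocoercivity. Maximality of the sum `A + C` is never needed. -/
theorem InclusionAssumption.mem_zer_of_isWeakLimit (hAC : InclusionAssumption M β A C)
    {F : Filter ℕ} [F.NeBot] {p y w : ℕ → H} {a : H} {R : ℝ}
    (hmem : ∀ n, M (w n) - C (y n) ∈ A (p n)) (hw : Tendsto w F (𝓝 0))
    (hyp : Tendsto (fun n => y n - p n) F (𝓝 0)) (hR : ∀ n, ‖p n‖ ≤ R)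
    (ha : IsWeakLimit F p a) : a ∈ zer (addSingle A C) := by
  obtain ⟨xs, hxs⟩ := hAC.zer_nonempty
  obtain ⟨K, hK, hC⟩ := hAC.cocoercive.exists_sq_norm_le hAC.metric hAC.beta_nonneg
  have hMw : Tendsto (fun n => M (w n)) F (𝓝 0) := by
    have h1 := (M.continuous.tendsto 0).comp hw
    rwa [map_zero] at h1
  have hCy : Tendsto (fun n => C (y n)) F (𝓝 (C xs)) := by
    have hbound : ∀ n, ‖C (y n) - C xs‖ ^ 2 ≤
        2 * K * inner ℝ (M (w n)) (p n - xs) + K ^ 2 * ‖y n - p n‖ ^ 2 := by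
      intro n
      have h1 := hAC.maximal.1 (p n, _) (hmem n) (xs, _) (mem_zer_iff.1 hxs)
      have h2 := hC (y n) xs
      have h3 : inner ℝ (M (w n) - C (y n) - -C xs) (p n - xs)
          = inner ℝ (M (w n)) (p n - xs) - inner ℝ (C (y n) - C xs) (p n - xs) := by
        rw [← inner_sub_left]
        congr 1
        abel
      have h4 : inner ℝ (C (y n) - C xs) (y n - xs) = inner ℝ (C (y n) - C xs) (p n - xs)
          + inner ℝ (C (y n) - C xs) (y n - p n) := by
        rw [← inner_add_right]
        congr 1
        abel
      have h5 := real_inner_le_norm (C (y n) - C xs) (y n - p n)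
      simp only [h3] at h1
      rw [h4] at h2
      have h6 := mul_le_mul_of_nonneg_left h5 hK
      have h7 := mul_nonneg hK h1
      nlinarith [sq_nonneg (‖C (y n) - C xs‖ - K * ‖y n - p n‖)]
    have hlim : Tendsto (fun n => 2 * K * inner ℝ (M (w n)) (p n - xs)
        + K ^ 2 * ‖y n - p n‖ ^ 2) F (𝓝 0) := by
      have h1 := (ha.tendsto_inner hR hMw).sub (hMw.inner (𝕜 := ℝ) (tendsto_const_nhds (x := xs)))
      have h2 := (h1.const_mul (2 * K)).add ((hyp.norm.pow 2).const_mul (K ^ 2))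
      simpa [inner_sub_right] using h2
    have h0 := squeeze_zero (fun n => by positivity) hbound hlim
    have h1 := h0.sqrt
    simp only [Real.sqrt_sq (norm_nonneg _), Real.sqrt_zero] at h1
    exact tendsto_iff_norm_sub_tendsto_zero.2 h1
  have hA : -C xs ∈ A a := by
    refine hAC.maximal.mem_of_forall fun q b hb => ?_
    have h1 : Tendsto (fun n => M (w n) - C (y n) - b) F (𝓝 (-C xs - b)) := by
      simpa using (hMw.sub hCy).sub_const b
    have h2 := (ha.tendsto_inner hR h1).sub (h1.inner (𝕜 := ℝ) (tendsto_const_nhds (x := q)))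
    simp only [← inner_sub_right] at h2
    exact ge_of_tendsto' h2 fun n => hAC.maximal.1 (p n, _) (hmem n) (q, b) hb
  have hCa : C xs = C a := by
    have h1 : Tendsto (fun n => C (y n) - C a) F (𝓝 (C xs - C a)) := hCy.sub_const _
    have h2 := ((ha.tendsto_inner hR h1).add (h1.inner (𝕜 := ℝ) hyp)).sub
      (h1.inner (𝕜 := ℝ) (tendsto_const_nhds (x := a)))
    simp only [← inner_add_right, ← inner_sub_right, add_sub_cancel, add_zero, sub_self,
      inner_zero_right] at h2
    have h3 := h2.const_mul K
    rw [mul_zero] at h3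
    have h4 := le_of_tendsto_of_tendsto' (h1.norm.pow 2) h3 fun n => hC (y n) a
    have h5 : ‖C xs - C a‖ = 0 := by simpa using le_antisymm h4 (by positivity)
    exact sub_eq_zero.1 (norm_eq_zero.1 h5)
  rw [mem_zer_iff, ← hCa]
  exact hA

end Closedness

/-! ### Descent and vanishing sequences -/

theorem summable_of_descent {V a : ℕ → ℝ} {c : ℝ} (hc : 0 < c) (ha : ∀ n, 0 ≤ a n)
    (hV : ∀ n, 0 ≤ V n) (h : ∀ n, V (n + 1) + c * a n ≤ V n) : Summable a := by
  refine summable_of_sum_range_le (c := V 0 / c) ha fun n => ?_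
  rw [le_div_iff₀ hc]
  have : V n + (∑ i ∈ Finset.range n, a i) * c ≤ V 0 := by
    induction n with
    | zero => simp
    | succ n ih =>
      rw [Finset.sum_range_succ]
      linarith [h n]
  linarith [hV n]

theorem tendsto_smul_zero_of_abs_le {c : ℕ → ℝ} {s : ℕ → H} {K : ℝ} (hc : ∀ n, |c n| ≤ K)
    (hs : Tendsto s atTop (𝓝 0)) : Tendsto (fun n => c n • s n) atTop (𝓝 0) := by
  have h1 : Tendsto (fun n => K * ‖s n‖) atTop (𝓝 0) := by
    simpa using hs.norm.const_mul K
  refine squeeze_zero_norm (fun n => ?_) h1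
  rw [norm_smul, Real.norm_eq_abs]
  gcongr
  exact hc n

theorem summable_prev_iff {s : ℕ → ℝ} : Summable (prev 0 s) ↔ Summable s :=
  (summable_nat_add_iff 1 (f := prev 0 s)).symm

/-! ### Uniform bounds for the coefficients -/

section Coefficients

variable {β ε ε₀ ε₁ : ℝ} {P : Params}

theorem Params.Assumption.abs_one_sub_le (h : P.Assumption β ε ε₀ ε₁) : |1 - P.lam 0| ≤ 1 :=
  abs_le.2 ⟨by linarith [h.lam_zero_lt], by linarith [h.lam_zero_pos]⟩

theorem Params.Assumption.le_θ (h : P.Assumption β ε ε₀ ε₁) (n : ℕ) :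
    P.lam n ^ 2 / P.lam 0 * ε ≤ P.θ n := by
  have := h.lam_zero_pos
  rw [h.θ_eq]
  gcongr
  exact h.ε_le n

theorem Params.Assumption.le_θtilde_div_θhat (h : P.Assumption β ε ε₀ ε₁) {n : ℕ}
    (hn : 0 < P.lam n) : ε / 2 ≤ P.θtilde n / P.θhat n := by
  have := h.lam_zero_pos
  have h1 := h.le_γ_mul n
  have h2 := h.ε_pos
  have hθ := h.θhat_pos hn
  rw [le_div_iff₀ hθ, h.θhat_eq, Params.θtilde, h.add_eq]
  have h3 : ε / 2 * (2 - P.γ n * P.βbar * P.lam 0) ≤ P.γ n * P.βbar := by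
    have := h1.trans' h2.le
    nlinarith [mul_nonneg h2.le (mul_nonneg this h.lam_zero_pos.le)]
  calc ε / 2 * (P.lam n ^ 2 / P.lam 0 * (2 - P.γ n * P.βbar * P.lam 0))
      = P.lam n ^ 2 / P.lam 0 * (ε / 2 * (2 - P.γ n * P.βbar * P.lam 0)) := by ring
    _ ≤ P.lam n ^ 2 / P.lam 0 * (P.γ n * P.βbar) := by gcongr
    _ = _ := by ring

theorem Params.Assumption.le_θhat_div_θ (h : P.Assumption β ε ε₀ ε₁) {n : ℕ}
    (hn : 0 < P.lam n) : ε * P.lam 0 / 4 ≤ P.θhat n / P.θ n := by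
  have h0 := h.lam_zero_pos
  have h1 := h.le_γ_mul n
  have h2 := h.ε_pos
  have hε := h.ε_mul_le n
  rw [le_div_iff₀ (h.θ_pos hn), h.θhat_eq, h.θ_eq]
  calc ε * P.lam 0 / 4 * (P.lam n ^ 2 / P.lam 0 * (4 - P.γ n * P.βbar - 2 * P.lam 0))
      ≤ ε * P.lam 0 / 4 * (P.lam n ^ 2 / P.lam 0 * 4) := by
        gcongr
        linarith
    _ = P.lam n ^ 2 / P.lam 0 * (ε * P.lam 0) := by ring
    _ ≤ _ := by gcongr

theorem Params.Assumption.abs_residual_coeff_u_le (h : P.Assumption β ε ε₀ ε₁) {n : ℕ}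
    (hn : 0 < P.lam n) :
    |P.γ n * P.βbar * P.lam n ^ 2 / P.θhat n| ≤ 4 / ε := by
  have h0 := h.lam_zero_pos
  have h2 := h.ε_pos
  have hg := h2.trans_le (h.le_γ_mul n)
  have hθ := h.θhat_pos hn
  rw [abs_of_nonneg (by positivity), div_le_div_iff₀ hθ h2, h.θhat_eq]
  calc P.γ n * P.βbar * P.lam n ^ 2 * ε ≤ 4 * P.lam n ^ 2 * ε := by
        gcongr
        exact (h.γ_mul_lt n).le
    _ = 4 * (P.lam n ^ 2 / P.lam 0 * (ε * P.lam 0)) := by field_simp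
    _ ≤ _ := by
        gcongr
        exact h.ε_mul_le n

theorem Params.Assumption.abs_z_coeff_u_le (h : P.Assumption β ε ε₀ ε₁) {n : ℕ}
    (hn : 0 < P.lam n) :
    |P.θbar n * (P.γ n * P.βbar) / P.θhat n| ≤ 4 / (ε * P.lam 0) := by
  have h0 := h.lam_zero_pos
  have h2 := h.ε_pos
  have hg := h2.trans_le (h.le_γ_mul n)
  have hθ := h.θhat_pos hn
  rw [abs_div, abs_of_pos hθ, div_le_div_iff₀ hθ (by positivity), h.θbar_eq, h.θhat_eq, abs_mul,
    abs_mul, abs_of_pos hg, abs_of_pos (by positivity : 0 < P.lam n ^ 2 / P.lam 0)]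
  calc P.lam n ^ 2 / P.lam 0 * |1 - P.lam 0| * (P.γ n * P.βbar) * (ε * P.lam 0)
      ≤ P.lam n ^ 2 / P.lam 0 * 1 * 4 * (ε * P.lam 0) := by
        gcongr
        · exact h.abs_one_sub_le
        · exact (h.γ_mul_lt n).le
    _ = 4 * (P.lam n ^ 2 / P.lam 0 * (ε * P.lam 0)) := by ring
    _ ≤ _ := by
        gcongr
        exact h.ε_mul_le n

theorem Params.Assumption.abs_residual_coeff_v_le (h : P.Assumption β ε ε₀ ε₁) {n : ℕ}
    (hn : 0 < P.lam n) : |2 * P.θbar n / P.θ n| ≤ 2 / ε := by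
  have h0 := h.lam_zero_pos
  have h2 := h.ε_pos
  have hθ := h.θ_pos hn
  rw [abs_div, abs_of_pos hθ, div_le_div_iff₀ hθ h2, h.θbar_eq, abs_mul, abs_mul,
    abs_of_pos (by positivity : 0 < P.lam n ^ 2 / P.lam 0), abs_two]
  calc 2 * (P.lam n ^ 2 / P.lam 0 * |1 - P.lam 0|) * ε
      ≤ 2 * (P.lam n ^ 2 / P.lam 0 * 1) * ε := by
        gcongr
        exact h.abs_one_sub_le
    _ = 2 * (P.lam n ^ 2 / P.lam 0 * ε) := by ring
    _ ≤ _ := by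
        gcongr
        exact h.le_θ n

end Coefficients

/-! ### Summability and convergence of the iterates -/

section Convergence

variable {M : H →L[ℝ] H} {A : H → Set H} {C : H → H} {β ε ε₀ ε₁ : ℝ}
  {P : Params} {S : Iterates H}

variable [CompleteSpace H]

theorem Iterates.IsGenerated.le_V (hS : S.IsGenerated P M A C)
    (hAC : InclusionAssumption M β A C) (hP : P.Admissible β)
    {xs : H} (hxs : xs ∈ zer (addSingle A C)) (n : ℕ) :
    mNorm M (S.x n - xs) ^ 2 + prev 0 (S.ell P M) n ≤ S.V P M xs n := by
  have h1 := hS.prev_phi_nonneg hAC hP hxs n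
  have h2 := hP.α_nonneg n
  have h3 := hP.γ_pos n
  have h4 := hP.lam_pos n
  have h5 : 0 ≤ 2 * P.lam n * P.γ n * P.α n * prev 0 (S.phi P M xs) n := by positivity
  rw [S.V_eq P M xs n]
  linarith

theorem Iterates.IsGenerated.V_nonneg (hS : S.IsGenerated P M A C)
    (hAC : InclusionAssumption M β A C) (hP : P.Admissible β) (h : P.Assumption β ε ε₀ ε₁)
    {xs : H} (hxs : xs ∈ zer (addSingle A C)) (n : ℕ) : 0 ≤ S.V P M xs n := by
  have h1 := hS.prev_ell_nonneg hAC hP h n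
  exact le_trans (by positivity) (hS.le_V hAC hP hxs n)

theorem Iterates.IsGenerated.antitone_V (hS : S.IsGenerated P M A C)
    (hAC : InclusionAssumption M β A C) (hP : P.Admissible β) (h : P.Assumption β ε ε₀ ε₁)
    {xs : H} (hxs : xs ∈ zer (addSingle A C)) : Antitone (S.V P M xs) := by
  refine antitone_nat_of_succ_le fun n => ?_
  have h1 := hS.prev_ell_nonneg hAC hP h n
  have h2 := hS.phi_nonneg hAC hP hxs n
  have h3 := h.ε₀_nonneg
  have h4 := h.ε₁_nonneg
  have h5 := hS.descent hAC hP h hxs n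
  have h6 : 0 ≤ 2 * ε₁ * S.phi P M xs n := by positivity
  have h7 : 0 ≤ ε₀ * prev 0 (S.ell P M) n := by positivity
  linarith

theorem Iterates.IsGenerated.tendsto_V (hS : S.IsGenerated P M A C)
    (hAC : InclusionAssumption M β A C) (hP : P.Admissible β) (h : P.Assumption β ε ε₀ ε₁)
    {xs : H} (hxs : xs ∈ zer (addSingle A C)) : ∃ L : ℝ, Tendsto (S.V P M xs) atTop (𝓝 L) :=
  ⟨_, tendsto_atTop_ciInf (hS.antitone_V hAC hP h hxs)
    ⟨0, Set.forall_mem_range.2 (hS.V_nonneg hAC hP h hxs)⟩⟩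

theorem Iterates.IsGenerated.ell_le_V (hS : S.IsGenerated P M A C)
    (hAC : InclusionAssumption M β A C) (hP : P.Admissible β)
    {xs : H} (hxs : xs ∈ zer (addSingle A C)) (n : ℕ) :
    S.ell P M n ≤ S.V P M xs (n + 1) :=
  le_trans (le_add_of_nonneg_left (by positivity)) (hS.le_V hAC hP hxs (n + 1))

theorem Iterates.IsGenerated.residual_le (hS : S.IsGenerated P M A C)
    (hAC : InclusionAssumption M β A C) (hP : P.Admissible β) (h : P.Assumption β ε ε₀ ε₁)
    {xs : H} (hxs : xs ∈ zer (addSingle A C)) (n : ℕ) :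
    mNorm M (S.residual P n) ^ 2 ≤ 2 * P.lam 0 * mNorm M (S.x 0 - xs) ^ 2 /
      ((4 - P.γ n * P.βbar - 2 * P.lam 0) * P.lam n ^ 2) := by
  have h0 := h.lam_zero_pos
  have hn := hP.lam_pos n
  have h1 := h.ε_pos.trans_le (h.ε_le n)
  have h2 : P.θ n / 2 * mNorm M (S.residual P n) ^ 2 ≤ mNorm M (S.x 0 - xs) ^ 2 :=
    (hS.le_ell hAC hP h n).trans ((hS.ell_le_V hAC hP hxs n).trans
      (hS.antitone_V hAC hP h hxs (Nat.zero_le (n + 1))))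
  rw [h.θ_eq] at h2
  rw [le_div_iff₀ (by positivity)]
  calc mNorm M (S.residual P n) ^ 2 * ((4 - P.γ n * P.βbar - 2 * P.lam 0) * P.lam n ^ 2)
      = 2 * P.lam 0 * (P.lam n ^ 2 / P.lam 0 * (4 - P.γ n * P.βbar - 2 * P.lam 0) / 2
        * mNorm M (S.residual P n) ^ 2) := by field_simp
    _ ≤ _ := by gcongr

theorem Iterates.IsGenerated.summable_ell (hS : S.IsGenerated P M A C)
    (hAC : InclusionAssumption M β A C) (hP : P.Admissible β) (h : P.Assumption β ε ε₀ ε₁)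
    (hε₀ : 0 < ε₀) : Summable (S.ell P M) := by
  obtain ⟨xs, hxs⟩ := hAC.zer_nonempty
  refine summable_prev_iff.1 (summable_of_descent hε₀ (hS.prev_ell_nonneg hAC hP h)
    (hS.V_nonneg hAC hP h hxs) fun n => ?_)
  have h1 := mul_nonneg (mul_nonneg zero_le_two h.ε₁_nonneg) (hS.phi_nonneg hAC hP hxs n)
  linarith [hS.descent hAC hP h hxs n]

theorem Iterates.IsGenerated.summable_phi (hS : S.IsGenerated P M A C)
    (hAC : InclusionAssumption M β A C) (hP : P.Admissible β) (h : P.Assumption β ε ε₀ ε₁)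
    {xs : H} (hxs : xs ∈ zer (addSingle A C)) (hε₁ : 0 < ε₁) : Summable (S.phi P M xs) := by
  refine summable_of_descent (c := 2 * ε₁) (by positivity) (hS.phi_nonneg hAC hP hxs)
    (hS.V_nonneg hAC hP h hxs) fun n => ?_
  have h1 := mul_nonneg h.ε₀_nonneg (hS.prev_ell_nonneg hAC hP h n)
  linarith [hS.descent hAC hP h hxs n]

theorem Iterates.IsGenerated.summable_sq_sub (hS : S.IsGenerated P M A C)
    (hAC : InclusionAssumption M β A C) (hP : P.Admissible β) (h : P.Assumption β ε ε₀ ε₁)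
    (hε₁ : 0 < ε₁) (hβ : β < P.βbar) :
    Summable (fun n => mNorm M (S.y n - S.p n) ^ 2) := by
  obtain ⟨xs, hxs⟩ := hAC.zer_nonempty
  have hpos : 0 < (P.βbar - β) / 4 := by linarith
  refine (summable_mul_left_iff hpos.ne').1 (Summable.of_nonneg_of_le (fun n => by positivity)
    (hS.le_phi hAC hP hxs) (hS.summable_phi hAC hP h hxs hε₁))

/-- The safeguard bounds the scaled deviations by the preceding value of `ℓ`. -/
theorem Iterates.IsGenerated.deviation_le (hS : S.IsGenerated P M A C)
    (hAC : InclusionAssumption M β A C) (hP : P.Admissible β) (h : P.Assumption β ε ε₀ ε₁)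
    (n : ℕ) :
    mNorm M (P.lam n • S.u n) ^ 2 * (ε / (2 * P.lam 0))
      + mNorm M (P.lam n • S.v n) ^ 2 * (ε / 4) ≤ prev 0 (S.ell P M) n := by
  have h0 := h.lam_zero_pos
  have hn := hP.lam_pos n
  have hs := hS.safeguard_prev n
  have hζ : P.ζ n * prev 0 (S.ell P M) n ≤ prev 0 (S.ell P M) n :=
    mul_le_of_le_one_left (hS.prev_ell_nonneg hAC hP h n)
      ((h.ζ_le n).trans (sub_le_self _ h.ε₀_nonneg))
  refine le_trans ?_ (hs.trans hζ)
  rw [h.add_eq, hAC.metric.mNorm_smul_sq, hAC.metric.mNorm_smul_sq]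
  calc P.lam n ^ 2 * mNorm M (S.u n) ^ 2 * (ε / (2 * P.lam 0))
        + P.lam n ^ 2 * mNorm M (S.v n) ^ 2 * (ε / 4)
      = P.lam n ^ 2 / P.lam 0 * (ε / 2 * mNorm M (S.u n) ^ 2
        + ε * P.lam 0 / 4 * mNorm M (S.v n) ^ 2) := by field_simp
    _ ≤ _ := mul_le_mul_of_nonneg_left (add_le_add
        (mul_le_mul_of_nonneg_right (h.le_θtilde_div_θhat hn) (by positivity))
        (mul_le_mul_of_nonneg_right (h.le_θhat_div_θ hn) (by positivity))) (by positivity)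

theorem Iterates.IsGenerated.tendsto_ell (hS : S.IsGenerated P M A C)
    (hAC : InclusionAssumption M β A C) (hP : P.Admissible β) (h : P.Assumption β ε ε₀ ε₁)
    (hε₀ : 0 < ε₀) : Tendsto (prev 0 (S.ell P M)) atTop (𝓝 0) :=
  (summable_prev_iff.2 (hS.summable_ell hAC hP h hε₀)).tendsto_atTop_zero

theorem Iterates.IsGenerated.tendsto_lam_smul_u (hS : S.IsGenerated P M A C)
    (hAC : InclusionAssumption M β A C) (hP : P.Admissible β) (h : P.Assumption β ε ε₀ ε₁)
    (hε₀ : 0 < ε₀) : Tendsto (fun n => P.lam n • S.u n) atTop (𝓝 0) := by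
  have h0 := h.lam_zero_pos
  have h1 := h.ε_pos
  have hc : 0 < ε / (2 * P.lam 0) := by positivity
  have hlim := (hS.tendsto_ell hAC hP h hε₀).div_const (ε / (2 * P.lam 0))
  rw [zero_div] at hlim
  refine hAC.metric.tendsto_zero (squeeze_zero (fun n => by positivity) (fun n => ?_) hlim)
  rw [le_div_iff₀ hc]
  exact le_trans (le_add_of_nonneg_right (by positivity)) (hS.deviation_le hAC hP h n)

theorem Iterates.IsGenerated.tendsto_lam_smul_v (hS : S.IsGenerated P M A C)
    (hAC : InclusionAssumption M β A C) (hP : P.Admissible β) (h : P.Assumption β ε ε₀ ε₁)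
    (hε₀ : 0 < ε₀) : Tendsto (fun n => P.lam n • S.v n) atTop (𝓝 0) := by
  have h0 := h.lam_zero_pos
  have h1 := h.ε_pos
  have hc : 0 < ε / 4 := by positivity
  have hlim := (hS.tendsto_ell hAC hP h hε₀).div_const (ε / 4)
  rw [zero_div] at hlim
  refine hAC.metric.tendsto_zero (squeeze_zero (fun n => by positivity) (fun n => ?_) hlim)
  rw [le_div_iff₀ hc]
  exact le_trans (le_add_of_nonneg_left (by positivity)) (hS.deviation_le hAC hP h n)

theorem Iterates.IsGenerated.tendsto_lam_smul_residual (hS : S.IsGenerated P M A C)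
    (hAC : InclusionAssumption M β A C) (hP : P.Admissible β) (h : P.Assumption β ε ε₀ ε₁)
    (hε₀ : 0 < ε₀) : Tendsto (fun n => P.lam n • S.residual P n) atTop (𝓝 0) := by
  have h0 := h.lam_zero_pos
  have h1 := h.ε_pos
  have hlim := (hS.summable_ell hAC hP h hε₀).tendsto_atTop_zero.const_mul (2 * P.lam 0 / ε)
  rw [mul_zero] at hlim
  refine hAC.metric.tendsto_zero (squeeze_zero (fun n => by positivity) (fun n => ?_) hlim)
  have h2 := hS.le_ell hAC hP h n
  rw [hAC.metric.mNorm_smul_sq]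
  calc P.lam n ^ 2 * mNorm M (S.residual P n) ^ 2
      = 2 * P.lam 0 / ε * (P.lam n ^ 2 / P.lam 0 * ε / 2 * mNorm M (S.residual P n) ^ 2) := by
        field_simp
    _ ≤ 2 * P.lam 0 / ε * (P.θ n / 2 * mNorm M (S.residual P n) ^ 2) := by
        gcongr
        exact h.le_θ n
    _ ≤ _ := by gcongr

theorem Iterates.IsGenerated.tendsto_x_succ_sub (hS : S.IsGenerated P M A C)
    (hAC : InclusionAssumption M β A C) (hP : P.Admissible β) (h : P.Assumption β ε ε₀ ε₁)
    (hε₀ : 0 < ε₀) : Tendsto (fun n => S.x (n + 1) - S.x n) atTop (𝓝 0) := by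
  have hu := hS.tendsto_lam_smul_u hAC hP h hε₀
  have hv := hS.tendsto_lam_smul_v hAC hP h hε₀
  have h1 := tendsto_smul_zero_of_abs_le
    (fun n => h.abs_residual_coeff_u_le (hP.lam_pos n)) hu
  have h2 := tendsto_smul_zero_of_abs_le (fun n => h.abs_z_coeff_u_le (hP.lam_pos n)) hu
  have h3 := tendsto_smul_zero_of_abs_le
    (fun n => h.abs_residual_coeff_v_le (hP.lam_pos n)) hv
  have h4 := ((((hS.tendsto_lam_smul_residual hAC hP h hε₀).sub h1).sub h2).add h3).sub hv
  simp only [sub_zero, add_zero] at h4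
  refine h4.congr fun n => ?_
  rw [hS.x_succ_eq n, Iterates.residual]
  module

/-- For bounded relaxation parameters, `V n` and the squared distance of `x n` to a zero have the
same limit, because the coefficients of the vanishing sequence `φ` stay bounded. -/
theorem Iterates.IsGenerated.tendsto_dist (hS : S.IsGenerated P M A C)
    (hAC : InclusionAssumption M β A C) (hP : P.Admissible β) (h : P.Assumption β ε ε₀ ε₁)
    (hε₀ : 0 < ε₀) (hε₁ : 0 < ε₁) (hlam : BddAbove (Set.range P.lam))
    {xs : H} (hxs : xs ∈ zer (addSingle A C)) :
    ∃ L : ℝ, Tendsto (fun n => mNorm M (S.x n - xs) ^ 2) atTop (𝓝 L) := by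
  obtain ⟨L, hL⟩ := hS.tendsto_V hAC hP h hxs
  obtain ⟨B, hB⟩ := hlam
  have hφ : Tendsto (prev 0 (S.phi P M xs)) atTop (𝓝 0) :=
    (summable_prev_iff.2 (hS.summable_phi hAC hP h hxs hε₁)).tendsto_atTop_zero
  have hβ := h.βbar_pos hP
  have hc : ∀ n, |2 * P.lam n * P.γ n * P.α n| ≤ 2 * B * (4 / P.βbar) * 1 := by
    intro n
    have h1 := hP.lam_pos n
    have h2 := hP.γ_pos n
    have h3 := hP.α_nonneg n
    have h4 : P.lam n ≤ B := hB ⟨n, rfl⟩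
    have h5 : 0 ≤ B := h1.le.trans h4
    rw [abs_of_nonneg (by positivity)]
    gcongr
    · exact h.γ_le hP n
    · exact div_le_one_of_le₀ (by linarith) (hP.add_pos n).le
  have h1 := (hL.sub (tendsto_smul_zero_of_abs_le hc hφ)).sub (hS.tendsto_ell hAC hP h hε₀)
  refine ⟨_, h1.congr fun n => ?_⟩
  rw [S.V_eq P M xs n, smul_eq_mul]
  ring

theorem Iterates.IsGenerated.bounded_x (hS : S.IsGenerated P M A C)
    (hAC : InclusionAssumption M β A C) (hP : P.Admissible β) (h : P.Assumption β ε ε₀ ε₁) :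
    ∃ R : ℝ, ∀ n, ‖S.x n‖ ≤ R := by
  obtain ⟨xs, hxs⟩ := hAC.zer_nonempty
  obtain ⟨-, c, hc, hcM⟩ := hAC.metric
  refine ⟨Real.sqrt (S.V P M xs 0 / c) + ‖xs‖, fun n => ?_⟩
  have h1 : c * ‖S.x n - xs‖ ^ 2 ≤ S.V P M xs 0 := by
    have h2 := hS.le_V hAC hP hxs n
    have h3 := hS.antitone_V hAC hP h hxs (Nat.zero_le n)
    have h4 := hS.prev_ell_nonneg hAC hP h n
    have h5 := hcM (S.x n - xs)
    rw [hAC.metric.mNorm_sq, mInner] at h2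
    linarith
  have h6 : ‖S.x n - xs‖ ≤ Real.sqrt (S.V P M xs 0 / c) := by
    refine Real.le_sqrt_of_sq_le ?_
    rw [le_div_iff₀ hc]
    linarith
  have h7 := norm_le_norm_sub_add (S.x n) xs
  linarith

theorem Iterates.IsGenerated.weaklyConverges (hS : S.IsGenerated P M A C)
    (hAC : InclusionAssumption M β A C) (hP : P.Admissible β) (h : P.Assumption β ε ε₀ ε₁)
    (hε₀ : 0 < ε₀) (hε₁ : 0 < ε₁) (hlam : BddAbove (Set.range P.lam))
    (hpx : Tendsto (fun n => S.p n - S.x n) atTop (𝓝 0))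
    (hyp : Tendsto (fun n => S.y n - S.p n) atTop (𝓝 0))
    (hzp : Tendsto (fun n => S.z n - S.p n) atTop (𝓝 0)) :
    ∃ a ∈ zer (addSingle A C), WeaklyConverges S.p a := by
  obtain ⟨R, hR⟩ := hS.bounded_x hAC hP h
  obtain ⟨Q, hQ⟩ := (Metric.isBounded_range_of_tendsto _ hpx).exists_norm_le
  have hp : ∀ n, ‖S.p n‖ ≤ Q + R := by
    intro n
    have h1 := norm_le_norm_sub_add (S.p n) (S.x n)
    have h2 := hQ _ ⟨n, rfl⟩
    linarith [hR n]
  have hβ := h.βbar_pos hP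
  have hw : Tendsto (fun n => (1 / P.γ n) • (S.z n - S.p n)) atTop (𝓝 0) := by
    refine tendsto_smul_zero_of_abs_le (K := 1 / (ε / P.βbar)) (fun n => ?_) hzp
    have h1 := hP.γ_pos n
    have h2 := h.ε_pos
    rw [abs_of_pos (by positivity)]
    gcongr
    exact h.le_γ hP n
  obtain ⟨a, ha, hxa⟩ := hAC.metric.opial hR
    (fun _ hb => hS.tendsto_dist hAC hP h hε₀ hε₁ hlam hb)
    (fun U a hU ha => hAC.mem_zer_of_isWeakLimit (hS.mem hP) (hw.mono_left hU)
      (hyp.mono_left hU) hp (ha.congr (hpx.mono_left hU)))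
  exact ⟨a, ha, (hxa.congr hpx).weaklyConverges⟩

/-- For constant relaxation parameters there is no momentum, and the vanishing of the residual and
of the deviations makes all iterates of one step asymptotically equal. -/
theorem Iterates.IsGenerated.weaklyConverges_of_const (hS : S.IsGenerated P M A C)
    (hAC : InclusionAssumption M β A C) (hP : P.Admissible β) (h : P.Assumption β ε ε₀ ε₁)
    (hε₀ : 0 < ε₀) (hε₁ : 0 < ε₁) (hlam : ∀ n, P.lam n = P.lam 0) :
    ∃ a ∈ zer (addSingle A C), WeaklyConverges S.p a := by
  have h0 := h.lam_zero_pos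
  have hα : ∀ n, P.α n = 0 := by
    intro n
    rw [h.α_eq (hP.lam_pos n), hlam n, div_self h0.ne', sub_self]
  have hαbar : ∀ n, P.αbar n = 0 := by
    intro n
    have hμ : P.μ n = 0 := by
      rw [h.μ_eq, hlam n]
      field_simp
      ring
    rw [Params.αbar, hμ, mul_zero, zero_div]
  have hdiv : ∀ {s : ℕ → H}, Tendsto (fun n => P.lam n • s n) atTop (𝓝 0) →
      Tendsto s atTop (𝓝 0) := by
    intro s hs
    have h1 := hs.const_smul (P.lam 0)⁻¹
    rw [smul_zero] at h1
    refine h1.congr fun n => ?_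
    rw [hlam n, smul_smul, inv_mul_cancel₀ h0.ne', one_smul]
  have hu := hdiv (hS.tendsto_lam_smul_u hAC hP h hε₀)
  have hv := hdiv (hS.tendsto_lam_smul_v hAC hP h hε₀)
  have hr := hdiv (hS.tendsto_lam_smul_residual hAC hP h hε₀)
  have h1 := tendsto_smul_zero_of_abs_le
    (fun n => h.abs_residual_coeff_u_le (hP.lam_pos n)) hu
  have h2 := tendsto_smul_zero_of_abs_le (fun n => h.abs_z_coeff_u_le (hP.lam_pos n)) hu
  have h3 := tendsto_smul_zero_of_abs_le
    (fun n => h.abs_residual_coeff_v_le (hP.lam_pos n)) hv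
  have hpx : Tendsto (fun n => S.p n - S.x n) atTop (𝓝 0) := by
    have h4 := (hr.sub h1).add h3
    simp only [sub_zero, add_zero] at h4
    refine h4.congr fun n => ?_
    rw [Iterates.residual, hα n]
    module
  refine hS.weaklyConverges hAC hP h hε₀ hε₁
    ⟨P.lam 0, Set.forall_mem_range.2 fun n => (hlam n).le⟩ hpx ?_ ?_
  · have h4 := hu.sub hpx
    rw [sub_zero] at h4
    refine h4.congr fun n => ?_
    rw [hS.y_eq n, hα n]
    module
  · have h4 := (h2.add hv).sub hpx
    simp only [sub_zero, add_zero] at h4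
    refine h4.congr fun n => ?_
    rw [hS.z_eq n, hα n, hαbar n, ← mul_assoc (P.θbar n)]
    module

end Convergence

end MomentumFB

theorem mainTheorem1 {H : Type*} [NormedAddCommGroup H] [InnerProductSpace ℝ H] [CompleteSpace H]
    (M : H →L[ℝ] H) (β : ℝ) (A : H → Set H) (C : H → H)
    (hAC : InclusionAssumption M β A C)
    (P : Params) (hP : P.Admissible β)
    (ε ε₀ ε₁ : ℝ) (hPar : P.Assumption β ε ε₀ ε₁)
    (S : Iterates H) (hS : S.IsGenerated P M A C)
    (xs : H) (hxs : xs ∈ zer (addSingle A C)) :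
    ((∃ L : ℝ, Tendsto (S.V P M xs) atTop (𝓝 L)) ∧
      ∀ n, S.ell P M n ≤ S.V P M xs (n + 1) ∧
        S.V P M xs (n + 1) ≤ mNorm M (S.x 0 - xs) ^ 2) ∧
    (Tendsto P.lam atTop atTop →
      ∀ n, mNorm M (S.residual P n) ^ 2 ≤
        2 * P.lam 0 * mNorm M (S.x 0 - xs) ^ 2 /
          ((4 - P.γ n * P.βbar - 2 * P.lam 0) * P.lam n ^ 2)) ∧
    (0 < ε₀ → Summable (S.ell P M)) ∧
    (0 < ε₀ →
      Tendsto (fun n => P.lam n • S.u n) atTop (𝓝 0) ∧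
      Tendsto (fun n => P.lam n • S.v n) atTop (𝓝 0) ∧
      Tendsto (fun n => S.x (n + 1) - S.x n) atTop (𝓝 0)) ∧
    (0 < ε₁ → Summable (S.phi P M xs)) ∧
    (0 < ε₁ → β < P.βbar → Summable (fun n => mNorm M (S.y n - S.p n) ^ 2)) ∧
    (0 < ε₀ → 0 < ε₁ → BddAbove (Set.range P.lam) →
      Tendsto (fun n => S.p n - S.x n) atTop (𝓝 0) →
      Tendsto (fun n => S.y n - S.p n) atTop (𝓝 0) →
      Tendsto (fun n => S.z n - S.p n) atTop (𝓝 0) →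
      ∃ a ∈ zer (addSingle A C), WeaklyConverges S.p a) ∧
    (0 < ε₀ → 0 < ε₁ → (∀ n, P.lam n = P.lam 0) →
      ∃ a ∈ zer (addSingle A C), WeaklyConverges S.p a) := by
  exact ⟨⟨hS.tendsto_V hAC hP hPar hxs, fun n => ⟨hS.ell_le_V hAC hP hxs n,
      hS.antitone_V hAC hP hPar hxs (Nat.zero_le (n + 1))⟩⟩,
    fun _ => hS.residual_le hAC hP hPar hxs, hS.summable_ell hAC hP hPar,
    fun h => ⟨hS.tendsto_lam_smul_u hAC hP hPar h, hS.tendsto_lam_smul_v hAC hP hPar h,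
      hS.tendsto_x_succ_sub hAC hP hPar h⟩,
    hS.summable_phi hAC hP hPar hxs, hS.summable_sq_sub hAC hP hPar,
    hS.weaklyConverges hAC hP hPar, hS.weaklyConverges_of_const hAC hP hPar⟩
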